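/- Let $G$ be a directed acyclic graph with vertex set $[n]=\{1,\dots,n\}$. For a vertex $i$ let $\mathbf{pa}(i)$ be its set of parents and $\mathbf{nd}(i)$ its set of non-descendants (the vertices $j\neq i$ that cannot be reached from $i$ by a directed path). Let $\Sigma\cong\mathbb{C}^{\binom{n+1}{2}}$ be the affine space of complex symmetric $n\times n$ matrices $[\sigma_{ij}]$, with coordinate ring $\mathbb{C}[\Sigma]=\mathbb{C}[\sigma_{ij}: i\le j]$. For $A\subseteq[n]$ write $|\Sigma_{AA}|\in\mathbb{C}[\Sigma]$ for the corresponding principal minor (equal to $1$ for $A=\emptyset$), put $\theta_0=\prod_{A\subseteq[n]}|\Sigma_{AA}|$ and $S=\{\theta_0^m : m\ge 1\}$, and let $\Sigma^{\circ}\subset\Sigma$ be the set of matrices all of whose principal minors are nonzero. Let $I_G\subset\mathbb{C}[\Sigma]$ be the ideal generated by the minors $|\sigma_{iK,jK}|$ (rows $\{i\}\cup K$, columns $\{j\}\cup K$) of the imposed (local Markov) relations $i\perp\!\!\!\perp j\mid K$, where $i\in[n]$, $K=\mathbf{pa}(i)$ and $j\in\mathbf{nd}(i)\setminus\mathbf{pa}(i)$.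 Let $\mathrm{loc}(G)\subset\Sigma$ be the set of covariance matrices of all (possibly singular) real Gaussian vectors $X=(X_1,\dots,X_n)$ that satisfy $X_i\perp\!\!\!\perp X_{\mathbf{nd}(i)}\mid X_{\mathbf{pa}(i)}$ for every $i\in[n]$; let $X_G$ be the Zariski closure of $\mathrm{loc}(G)$ in $\Sigma$, and let $\mathfrak{p}_G=I(X_G)\subset\mathbb{C}[\Sigma]$ be the ideal of polynomials vanishing on $X_G$. Then: (a) There is a Zariski closed subset $B_G\subseteq\{\theta_0=0\}$ of $\Sigma$ such that $V(I_G)=X_G\cup B_G$. (b) $\mathfrak{p}_G=I(\mathrm{loc}(G))$ and $X_G=V(\mathfrak{p}_G)$. The ideal $\mathfrak{p}_G$ is prime and is the saturation of $I_G$ at $S$: $\mathfrak{p}_G=S^{-1}I_G\cap\mathbb{C}[\Sigma]$, that is, the preimage in $\mathbb{C}[\Sigma]$ of the extension of $I_G$ to $S^{-1}\mathbb{C}[\Sigma]$. (c) $X_G$ is smooth at each of its points that lie in $\Sigma^{\circ}$. -/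

import Mathlib

noncomputable section

open MvPolynomial ProbabilityTheory MeasureTheory

open scoped Classical

namespace GaussianDAG

/-! ### Directed acyclic graphs and their local Markov relations -/

/-- A digraph is acyclic when no vertex lies on a (nonempty) directed closed walk. -/
def IsAcyclic {n : ℕ} (G : Digraph (Fin n)) : Prop :=
  ∀ i, ¬ Relation.TransGen G.Adj i i

/-- The set of parents of `i`. -/
def parents {n : ℕ} (G : Digraph (Fin n)) (i : Fin n) : Finset (Fin n) :=
  Finset.univ.filter fun k => G.Adj k i

/-- The set of non-descendants of `i`: the vertices other than `i` that cannot be reached from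
`i` by a directed path. -/
def nonDesc {n : ℕ} (G : Digraph (Fin n)) (i : Fin n) : Finset (Fin n) :=
  Finset.univ.filter fun j => j ≠ i ∧ ¬ Relation.TransGen G.Adj i j

/-- The restriction `x ↦ x_A` of a vector to the coordinates in `A`. -/
def proj {n : ℕ} (A : Finset (Fin n)) (x : Fin n → ℝ) : A → ℝ := fun a => x a

lemma measurable_proj {n : ℕ} (A : Finset (Fin n)) : Measurable (proj A) :=
  measurable_pi_lambda _ fun a => measurable_pi_apply (a : Fin n)

/-- `Loc(G)`: the laws on `ℝⁿ` of the random vectors `X = (X₁, …, Xₙ)` satisfying all imposed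
(local Markov) relations `X_i ⫫ X_{nd(i)} | X_{pa(i)}`. -/
def Loc {n : ℕ} (G : Digraph (Fin n)) : Set (ProbabilityMeasure (Fin n → ℝ)) :=
  {P | ∀ i, CondIndepFun
      (MeasurableSpace.comap (proj (parents G i)) inferInstance)
      (measurable_proj (parents G i)).comap_le
      (fun x : Fin n → ℝ => x i) (proj (nonDesc G i)) (P : Measure (Fin n → ℝ))}

/-! ### The affine space of symmetric matrices -/

/-- The affine space `Σ = ℂ^{n(n+1)/2}` of symmetric matrices `[σ_{ij}]`; the coordinate `σ_{ij}`
is indexed by the unordered pair `s(i, j)` (with `i = j` allowed). -/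
abbrev SymSpace (n : ℕ) : Type := Sym2 (Fin n) → ℂ

/-- The coordinate ring `ℂ[Σ]`. -/
abbrev SymRing (n : ℕ) : Type := MvPolynomial (Sym2 (Fin n)) ℂ

/-- The generic symmetric matrix `[σ_{ij}]` over `ℂ[Σ]`. -/
def genericMatrix (n : ℕ) : Matrix (Fin n) (Fin n) (SymRing n) :=
  Matrix.of fun i j => X s(i, j)

/-- The principal minor `|Σ_{AA}|` (equal to `1` for `A = ∅`). -/
def principalMinor {n : ℕ} (A : Finset (Fin n)) : SymRing n :=
  ((genericMatrix n).submatrix (fun a : A => (a : Fin n)) (fun a : A => (a : Fin n))).det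

/-- `θ₀`, the product of all principal minors. -/
def theta (n : ℕ) : SymRing n := ∏ A : Finset (Fin n), principalMinor A

/-- The locus `Σ°` of the matrices all of whose principal minors are nonzero. -/
def nonsingularLocus (n : ℕ) : Set (SymSpace n) :=
  {x | ∀ A : Finset (Fin n), aeval x (principalMinor A) ≠ 0}

/-- The minor `|σ_{iK,jK}|` with rows `i, K` and columns `j, K`; the index `none` stands for `i`
among the rows and for `j` among the columns. -/
def ciMinor {n : ℕ} (i j : Fin n) (K : Finset (Fin n)) : SymRing n :=
  ((genericMatrix n).submatrix
    (fun a : Option K => a.elim i fun k => (k : Fin n))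
    (fun a : Option K => a.elim j fun k => (k : Fin n))).det

/-- `I_G`: the ideal generated by the minors `|σ_{iK,jK}|` of the imposed relations
`i ⫫ j | K`, where `K = pa(i)` and `j` is a non-descendant of `i` outside `K`. -/
def imposedIdeal {n : ℕ} (G : Digraph (Fin n)) : Ideal (SymRing n) :=
  Ideal.span {f | ∃ i j, j ∈ nonDesc G i ∧ j ∉ parents G i ∧ f = ciMinor i j (parents G i)}

/-! ### The variety of a DAG -/

/-- `loc(G)`: the covariance matrices, possibly singular, of the real Gaussian laws in `Loc(G)`,
as points of `Σ`. -/
def loc {n : ℕ} (G : Digraph (Fin n)) : Set (SymSpace n) :=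
  {σ | ∃ P ∈ Loc G, IsGaussian (P : Measure (Fin n → ℝ)) ∧
    ∀ i j, σ s(i, j) =
      ((covariance (fun x : Fin n → ℝ => x i) (fun x : Fin n → ℝ => x j)
        (P : Measure (Fin n → ℝ)) : ℝ) : ℂ)}

/-- A Zariski closed subset of affine space. -/
def IsZariskiClosed {ι : Type*} (Z : Set (ι → ℂ)) : Prop :=
  ∃ I : Ideal (MvPolynomial ι ℂ), Z = zeroLocus ℂ I

/-- The Zariski closure: the intersection of all Zariski closed sets containing `S`. -/
def zariskiClosure {ι : Type*} (S : Set (ι → ℂ)) : Set (ι → ℂ) :=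
  ⋂₀ {Z | IsZariskiClosed Z ∧ S ⊆ Z}

/-- `X_G`, the Zariski closure of `loc(G)` in `Σ`. -/
def dagVariety {n : ℕ} (G : Digraph (Fin n)) : Set (SymSpace n) := zariskiClosure (loc G)

/-- `𝔭_G = I(X_G)`. -/
def dagIdeal {n : ℕ} (G : Digraph (Fin n)) : Ideal (SymRing n) :=
  vanishingIdeal ℂ (dagVariety G)

/-- The contraction `S⁻¹I ∩ R` to `R` of the extension of `I` to the localization `S⁻¹R` at the
powers of `f`. -/
def saturation {R : Type*} [CommRing R] (I : Ideal R) (f : R) : Ideal R :=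
  (I.map (algebraMap R (Localization.Away f))).comap (algebraMap R (Localization.Away f))

/-! ### Smooth points -/

/-- The coordinate ring `ℂ[Z] = ℂ[x]/I(Z)` of a subset `Z` of affine space. -/
abbrev CoordRing {ι : Type*} (Z : Set (ι → ℂ)) : Type _ :=
  MvPolynomial ι ℂ ⧸ vanishingIdeal ℂ Z

/-- Evaluation of functions in `ℂ[Z]` at a point `x` of `Z`. -/
def evalAt {ι : Type*} {Z : Set (ι → ℂ)} {x : ι → ℂ} (hx : x ∈ Z) : CoordRing Z →ₐ[ℂ] ℂ :=
  Ideal.Quotient.liftₐ (vanishingIdeal ℂ Z) (aeval x) fun _ hp => hp x hx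

/-- The maximal ideal of `ℂ[Z]` of the functions vanishing at the point `x` of `Z`. -/
def pointIdeal {ι : Type*} {Z : Set (ι → ℂ)} {x : ι → ℂ} (hx : x ∈ Z) : Ideal (CoordRing Z) :=
  RingHom.ker (evalAt hx)

instance {ι : Type*} {Z : Set (ι → ℂ)} {x : ι → ℂ} (hx : x ∈ Z) : (pointIdeal hx).IsPrime :=
  RingHom.ker_isPrime (evalAt hx)

/-- The variety `Z` is smooth (over `ℂ`) at its point `x`. -/
def IsSmoothAtPoint {ι : Type*} (Z : Set (ι → ℂ)) {x : ι → ℂ} (hx : x ∈ Z) : Prop :=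
  Algebra.IsSmoothAt ℂ (pointIdeal hx)

end GaussianDAG

end

noncomputable section

open MvPolynomial ProbabilityTheory MeasureTheory

open scoped Classical

namespace GaussianDAG

/-! ### Acyclic digraphs -/

section Combinatorics

variable {n : ℕ} {G : Digraph (Fin n)}

/-! Everything rests on the structural equations `IsStructural`, taken over an arbitrary commutative
ring. By acyclicity the coefficients `l` and error variances `w` determine the covariances
polynomially (`IsStructural.unique`, `isStructural_structuralCov`). This gives a map `param` from
ℂ[Σ] to a polynomial ring, and evaluation at any structural `S` factors through it
(`IsStructural.evalParam_param`). Conversely, `S` is structural as soon as it kills `I_G` and makes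
the principal minors of the parent sets units (`exists_isStructural`, a Schur complement).

Applied over S⁻¹ℂ[Σ]/S⁻¹I_G, this puts the kernel of `param` inside the saturation of `I_G`; the
reverse inclusion holds because `param` kills `I_G` but not θ₀. The kernel is also the ideal of
loc(G): real structural covariances with nonnegative variances lie in loc(G) and are Zariski dense
in the image, and every point of loc(G), even a singular one, is structural by least squares
regression. Hence 𝔭_G is prime and equals the saturation, and V(I_G) differs from X_G only where θ₀
= 0.

Applied over the local ring of X_G at a point of Σ°, the same converse factors the localization map
through a polynomial ring, which forces smoothness. -/

lemma mem_parents {i k : Fin n} : k ∈ parents G i ↔ G.Adj k i := by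
  simp [parents]

lemma mem_nonDesc {i j : Fin n} : j ∈ nonDesc G i ↔ j ≠ i ∧ ¬ Relation.TransGen G.Adj i j := by
  simp [nonDesc]

lemma IsAcyclic.parents_subset_nonDesc (hG : IsAcyclic G) (i : Fin n) :
    parents G i ⊆ nonDesc G i := by
  intro k hk
  rw [mem_parents] at hk
  refine mem_nonDesc.2 ⟨?_, fun h => hG i (h.tail hk)⟩
  rintro rfl
  exact hG k (.single hk)

lemma IsAcyclic.mem_nonDesc_or (hG : IsAcyclic G) {i j : Fin n} (hij : i ≠ j) :
    j ∈ nonDesc G i ∨ i ∈ nonDesc G j := by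
  by_contra! h
  simp only [mem_nonDesc, not_and, not_not] at h
  exact hG i ((h.1 hij.symm).trans (h.2 hij))

/-- The number of proper ancestors of a vertex. -/
def height (G : Digraph (Fin n)) (i : Fin n) : ℕ :=
  (Finset.univ.filter fun j => Relation.TransGen G.Adj j i).card

lemma IsAcyclic.height_lt (hG : IsAcyclic G) {k i : Fin n} (h : G.Adj k i) :
    height G k < height G i := by
  refine Finset.card_lt_card (Finset.ssubset_iff_of_subset ?_ |>.2 ⟨k, ?_, ?_⟩)
  · intro j hj
    simp only [Finset.mem_filter, Finset.mem_univ, true_and] at hj ⊢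
    exact hj.tail h
  · simpa using Relation.TransGen.single h
  · simpa using hG k

lemma height_le (i : Fin n) : height G i ≤ n := by
  simpa [height] using Finset.card_le_univ (Finset.univ.filter fun j => Relation.TransGen G.Adj j i)

end Combinatorics

/-! ### Structural equations -/

/-- `S` is the matrix of covariances of a linear structural equation model on `G` with
coefficients `l` and error variances `w`. -/
structure IsStructural {n : ℕ} (G : Digraph (Fin n)) {R : Type*} [CommRing R]
    (S : Sym2 (Fin n) → R) (l : Fin n → Fin n → R) (w : Fin n → R) : Prop where
  nonDesc_eq : ∀ i, ∀ j ∈ nonDesc G i, S s(i, j) = ∑ k ∈ parents G i, l i k * S s(k, j)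
  diag_eq : ∀ i, S s(i, i) = ∑ k ∈ parents G i, l i k * S s(k, i) + w i

namespace IsStructural

variable {n : ℕ} {G : Digraph (Fin n)} {R R' : Type*} [CommRing R] [CommRing R']
  {S S' : Sym2 (Fin n) → R} {l : Fin n → Fin n → R} {w : Fin n → R}

lemma map (h : IsStructural G S l w) (f : R →+* R') :
    IsStructural G (fun z => f (S z)) (fun i k => f (l i k)) fun i => f (w i) where
  nonDesc_eq i j hj := by simp [h.nonDesc_eq i j hj]
  diag_eq i := by simp [h.diag_eq i]

/-- Induction on the sum of the two heights. Of two distinct vertices one is a non-descendant of the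
other, so an equation always applies, and its right side replaces a vertex by parents, which have
smaller height. -/
lemma unique (hG : IsAcyclic G) (h : IsStructural G S l w) (h' : IsStructural G S' l w) :
    S = S' := by
  suffices H : ∀ m i j, height G i + height G j < m → S s(i, j) = S' s(i, j) by
    funext z
    induction z with | h i j => exact H _ i j (Nat.lt_succ_self _)
  intro m
  induction m with
  | zero => intro i j hm; omega
  | succ m ih =>
    have step : ∀ i j, height G i + height G j < m + 1 → ∀ k ∈ parents G i,
        S s(k, j) = S' s(k, j) := fun i j hm k hk =>
      ih k j (by have := hG.height_lt (mem_parents.1 hk); omega)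
    have off : ∀ i j, height G i + height G j < m + 1 → j ∈ nonDesc G i →
        S s(i, j) = S' s(i, j) := fun i j hm hj => by
      rw [h.nonDesc_eq i j hj, h'.nonDesc_eq i j hj]
      exact Finset.sum_congr rfl fun k hk => by rw [step i j hm k hk]
    intro i j hm
    by_cases hij : i = j
    · subst hij
      rw [h.diag_eq, h'.diag_eq]
      exact congrArg (· + w i) (Finset.sum_congr rfl fun k hk => by rw [step i i hm k hk])
    · rcases hG.mem_nonDesc_or hij with hj | hi
      · exact off i j hm hj
      · rw [Sym2.eq_swap]
        exact off j i (by omega) hi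

end IsStructural

/-! ### Solving the structural equations by summing over directed paths -/

section Existence

variable {n : ℕ} {G : Digraph (Fin n)} {R : Type*} [CommRing R]

/-- The strictly triangular matrix of the edge coefficients. -/
def edgeMatrix (G : Digraph (Fin n)) (l : Fin n → Fin n → R) : Matrix (Fin n) (Fin n) R :=
  Matrix.of fun i k => if k ∈ parents G i then l i k else 0

/-- The matrix `(1 - Λ)⁻¹` expressing the variables through the errors. -/
def pathMatrix (G : Digraph (Fin n)) (l : Fin n → Fin n → R) : Matrix (Fin n) (Fin n) R :=
  ∑ t ∈ Finset.range (n + 1), edgeMatrix G l ^ t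

/-- The covariance matrix with coefficients `l` and error variances `w`. -/
def structuralCov (G : Digraph (Fin n)) (l : Fin n → Fin n → R) (w : Fin n → R) :
    Sym2 (Fin n) → R :=
  Sym2.lift ⟨fun i j => ∑ a, pathMatrix G l i a * w a * pathMatrix G l j a,
    fun i j => Finset.sum_congr rfl fun a _ => by ring⟩

lemma structuralCov_mk (l : Fin n → Fin n → R) (w : Fin n → R) (i j : Fin n) :
    structuralCov G l w s(i, j) = ∑ a, pathMatrix G l i a * w a * pathMatrix G l j a := rfl

/-- The entry is a sum over directed walks of length `t` from `i` to `j`, and each edge raises the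
height. This yields both the triangular shape of `pathMatrix` and, heights being at most `n`, the
vanishing of the power `n + 1`. -/
lemma edgeMatrix_pow_ne_zero (hG : IsAcyclic G) (l : Fin n → Fin n → R) (t : ℕ) :
    ∀ j i, (edgeMatrix G l ^ t) j i ≠ 0 →
      Relation.ReflTransGen G.Adj i j ∧ height G i + t ≤ height G j := by
  induction t with
  | zero =>
    intro j i h
    have : j = i := by
      by_contra hji
      exact h (by simp [hji])
    subst this
    exact ⟨.refl, by simp⟩
  | succ t ih =>
    intro j i h
    rw [pow_succ', Matrix.mul_apply] at h
    obtain ⟨k, -, hk⟩ := Finset.exists_ne_zero_of_sum_ne_zero h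
    have hkj : k ∈ parents G j := by
      by_contra hn
      exact hk (by simp [edgeMatrix, hn])
    have h2 := ih k i (right_ne_zero_of_mul hk)
    rw [mem_parents] at hkj
    exact ⟨h2.1.tail hkj, by have := hG.height_lt hkj; omega⟩

lemma pathMatrix_eq_zero (hG : IsAcyclic G) (l : Fin n → Fin n → R) {i j : Fin n}
    (hj : j ∈ nonDesc G i) : pathMatrix G l j i = 0 := by
  rw [pathMatrix, Matrix.sum_apply]
  refine Finset.sum_eq_zero fun t _ => ?_
  by_contra h
  have h1 := (edgeMatrix_pow_ne_zero hG l t j i h).1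
  rw [mem_nonDesc] at hj
  rcases Relation.reflTransGen_iff_eq_or_transGen.1 h1 with h2 | h2
  · exact hj.1 h2
  · exact hj.2 h2

lemma pathMatrix_eq (hG : IsAcyclic G) (l : Fin n → Fin n → R) :
    pathMatrix G l = 1 + edgeMatrix G l * pathMatrix G l := by
  have h0 : edgeMatrix G l ^ (n + 1) = 0 := by
    ext j i
    by_contra h
    have := (edgeMatrix_pow_ne_zero hG l _ j i h).2
    have := height_le (G := G) j
    omega
  have := mul_neg_geom_sum (edgeMatrix G l) (n + 1)
  rw [h0, sub_zero, sub_mul, one_mul] at this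
  exact sub_eq_iff_eq_add.1 this

lemma pathMatrix_apply (hG : IsAcyclic G) (l : Fin n → Fin n → R) (i j : Fin n) :
    pathMatrix G l i j =
      (if i = j then 1 else 0) + ∑ k ∈ parents G i, l i k * pathMatrix G l k j := by
  conv_lhs => rw [pathMatrix_eq hG]
  rw [Matrix.add_apply, Matrix.mul_apply, Matrix.one_apply]
  simp [edgeMatrix, ite_mul]

lemma pathMatrix_self (hG : IsAcyclic G) (l : Fin n → Fin n → R) (i : Fin n) :
    pathMatrix G l i i = 1 := by
  rw [pathMatrix_apply hG, if_pos rfl, Finset.sum_eq_zero, add_zero]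
  intro k hk
  rw [pathMatrix_eq_zero hG l (hG.parents_subset_nonDesc i hk), mul_zero]

lemma isStructural_structuralCov (hG : IsAcyclic G) (l : Fin n → Fin n → R) (w : Fin n → R) :
    IsStructural G (structuralCov G l w) l w := by
  -- The last term is the covariance of the error at `i` with the variable at `j`: it is 0 for a
  -- non-descendant `j` and `w i` for `j = i`.
  have key : ∀ i j, structuralCov G l w s(i, j) =
      ∑ k ∈ parents G i, l i k * structuralCov G l w s(k, j) + w i * pathMatrix G l j i := by
    intro i j
    simp only [structuralCov_mk]
    conv_lhs => enter [2, a]; rw [pathMatrix_apply hG l i a]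
    simp only [add_mul, Finset.sum_add_distrib, ite_mul, one_mul, zero_mul, Finset.sum_ite_eq,
      Finset.mem_univ, if_true, Finset.sum_mul, Finset.mul_sum]
    rw [add_comm, Finset.sum_comm]
    simp only [mul_assoc]
  refine ⟨fun i j hj => ?_, fun i => ?_⟩
  · rw [key, pathMatrix_eq_zero hG l hj, mul_zero, add_zero]
  · rw [key, pathMatrix_self hG, mul_one]

end Existence

/-! ### Minors and structural equations -/

section Minors

variable {n : ℕ} {G : Digraph (Fin n)} {R : Type*} [CommRing R] [Algebra ℂ R]

/-- The symmetric matrix with entries `S`. -/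
def symMatrix {R : Type*} (S : Sym2 (Fin n) → R) : Matrix (Fin n) (Fin n) R :=
  Matrix.of fun i j => S s(i, j)

lemma aeval_principalMinor (S : Sym2 (Fin n) → R) (A : Finset (Fin n)) :
    aeval S (principalMinor A) =
      ((symMatrix S).submatrix (fun a : A => (a : Fin n)) (fun a : A => (a : Fin n))).det := by
  rw [principalMinor, AlgHom.map_det]
  congr 1
  ext i j
  simp [genericMatrix, symMatrix]

lemma aeval_ciMinor (S : Sym2 (Fin n) → R) (i j : Fin n) (K : Finset (Fin n)) :
    aeval S (ciMinor i j K) = ((symMatrix S).submatrix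
      (fun a : Option K => a.elim i fun k => (k : Fin n))
      (fun a : Option K => a.elim j fun k => (k : Fin n))).det := by
  rw [ciMinor, AlgHom.map_det]
  congr 1
  ext i j
  simp [genericMatrix, symMatrix]

lemma IsStructural.aeval_ciMinor_eq_zero [IsDomain R] (hG : IsAcyclic G) {S : Sym2 (Fin n) → R}
    {l : Fin n → Fin n → R} {w : Fin n → R} (h : IsStructural G S l w) {i j : Fin n}
    (hj : j ∈ nonDesc G i) : aeval S (ciMinor i j (parents G i)) = 0 := by
  rw [aeval_ciMinor, ← Matrix.exists_vecMul_eq_zero_iff]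
  -- The regression relation is a left kernel vector, with -1 in the row of `i`. It also annihilates
  -- the columns in `K`, because parents are non-descendants.
  refine ⟨fun a => a.elim (-1) fun k => l i k, fun h0 => ?_, ?_⟩
  · simpa using congrFun h0 none
  · have key : ∀ b ∈ nonDesc G i,
        -1 * S s(i, b) + ∑ k : parents G i, l i k * S s((k : Fin n), b) = 0 := by
      intro b hb
      rw [h.nonDesc_eq i b hb, Finset.sum_coe_sort (parents G i) fun k => l i k * S s(k, b)]
      ring
    funext b
    simp only [Matrix.vecMul, dotProduct, Fintype.sum_option, Matrix.submatrix_apply, symMatrix,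
      Matrix.of_apply, Option.elim, Pi.zero_apply]
    cases b with
    | none => exact key j hj
    | some b => exact key b (hG.parents_subset_nonDesc i b.2)

/-- The coefficients at `i` are forced: they are the row `v` times the inverse of the parent block
`D`. Equations at parents then hold by construction; at other non-descendants they say that the
Schur complement of `D` in the imposed minor vanishes. The error variances are unconstrained and
absorb the diagonal equations. -/
lemma exists_isStructural (S : Sym2 (Fin n) → R)
    (hu : ∀ i, IsUnit (aeval S (principalMinor (parents G i))))
    (hz : ∀ f ∈ imposedIdeal G, aeval S f = 0) :
    ∃ l w, IsStructural G S l w := by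
  suffices H : ∀ i, ∃ l : Fin n → R, ∀ j ∈ nonDesc G i,
      S s(i, j) = ∑ k ∈ parents G i, l k * S s(k, j) by
    choose l hl using H
    exact ⟨l, fun i => S s(i, i) - ∑ k ∈ parents G i, l i k * S s(k, i), hl, fun i => by ring⟩
  intro i
  set K := parents G i with hK
  set D : Matrix K K R := (symMatrix S).submatrix (fun a : K => (a : Fin n)) (fun a : K => (a : Fin n))
    with hD
  have hDu : IsUnit D.det := by rw [hD, ← aeval_principalMinor]; exact hu i
  let : Invertible D := Matrix.invertibleOfIsUnitDet D hDu
  let v : K → R := fun k => S s(i, k)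
  refine ⟨fun k => if hk : k ∈ K then (Matrix.vecMul v ⅟D) ⟨k, hk⟩ else 0, fun j hj => ?_⟩
  have hsum : ∑ k ∈ K, (if hk : k ∈ K then (Matrix.vecMul v ⅟D) ⟨k, hk⟩ else 0) * S s(k, j) =
      ∑ k : K, (Matrix.vecMul v ⅟D) k * S s((k : Fin n), j) := by
    rw [← Finset.sum_coe_sort K]
    exact Finset.sum_congr rfl fun k _ => by simp
  rw [hsum]
  by_cases hjK : j ∈ K
  · have h1 : Matrix.vecMul (Matrix.vecMul v ⅟D) D = v := by
      rw [Matrix.vecMul_vecMul, invOf_mul_self, Matrix.vecMul_one]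
    exact (congrFun h1 ⟨j, hjK⟩).symm
  · have h0 : aeval S (ciMinor i j K) = 0 := hz _ (Ideal.subset_span ⟨i, j, hj, hjK, rfl⟩)
    rw [aeval_ciMinor, ← Matrix.det_submatrix_equiv_self (Equiv.sumComm K Unit |>.symm.trans
      (Equiv.optionEquivSumPUnit K).symm)] at h0
    -- Splitting off the index `none` makes the minor equal to `det D` times the 1 × 1 Schur
    -- complement; as `det D` is a unit, the latter is zero.
    let A : Matrix Unit Unit R := Matrix.of fun _ _ => S s(i, j)
    let B : Matrix Unit K R := Matrix.of fun _ k => S s(i, k)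
    let C : Matrix K Unit R := Matrix.of fun k _ => S s((k : Fin n), j)
    have hblock : Matrix.fromBlocks A B C D = ((symMatrix S).submatrix
        (fun a : Option K => a.elim i fun k => (k : Fin n))
        (fun a : Option K => a.elim j fun k => (k : Fin n))).submatrix
          (Equiv.sumComm K Unit |>.symm.trans (Equiv.optionEquivSumPUnit K).symm)
          (Equiv.sumComm K Unit |>.symm.trans (Equiv.optionEquivSumPUnit K).symm) := by
      ext (a | a) (b | b) <;> simp [A, B, C, D, symMatrix]
    rw [← hblock, Matrix.det_fromBlocks₂₂, hDu.mul_right_eq_zero, Matrix.det_unique] at h0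
    exact sub_eq_zero.1 h0

end Minors

/-! ### Covariances in Gaussian laws and conditional independence -/

section CondIndep

variable {Ω γ δ : Type*} [mΩ : MeasurableSpace Ω] [mγ : MeasurableSpace γ]
  [mδ : MeasurableSpace δ] {μ : Measure Ω}

/-- The kernel `u ↦ law of h u + ε` where `ε` has law `ν`. -/
def shiftKernel (ν : Measure ℝ) (h : γ → ℝ) : Kernel γ ℝ :=
  (Kernel.id ×ₖ Kernel.const γ ν).map fun p : γ × ℝ => h p.1 + p.2

lemma shiftKernel_apply (ν : Measure ℝ) [IsProbabilityMeasure ν] {h : γ → ℝ} (hh : Measurable h)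
    (u : γ) : shiftKernel ν h u = ν.map fun y => h u + y := by
  rw [shiftKernel, Kernel.map_apply _ (by fun_prop), Kernel.prod_apply, Kernel.id_apply,
    Kernel.const_apply, Measure.dirac_prod, Measure.map_map (by fun_prop) (by fun_prop)]
  rfl

instance (ν : Measure ℝ) [IsProbabilityMeasure ν] (h : γ → ℝ) :
    IsFiniteKernel (shiftKernel ν h) := by
  unfold shiftKernel
  infer_instance

/-- The residual `Y - h(U)` has law `ν` and is independent of `U` iff the conditional law of `Y`
given `U` is the corresponding shift of `ν`. -/
lemma map_prodMk_eq_compProd_shiftKernel_iff [IsProbabilityMeasure μ] (ν : Measure ℝ)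
    [IsProbabilityMeasure ν] {h : γ → ℝ} (hh : Measurable h) {U : Ω → γ} (hU : Measurable U)
    {Y : Ω → ℝ} (hY : Measurable Y) :
    μ.map (fun ω => (U ω, Y ω)) = μ.map U ⊗ₘ shiftKernel ν h ↔
      μ.map (fun ω => (U ω, Y ω - h (U ω))) = (μ.map U).prod ν := by
  have : IsProbabilityMeasure (μ.map U) := Measure.isProbabilityMeasure_map hU.aemeasurable
  -- This shear carries (U, Y - h(U)) to (U, Y) and the product measure to the composition with
  -- `shiftKernel`.
  let e : γ × ℝ ≃ᵐ γ × ℝ :=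
    { toFun := fun p => (p.1, h p.1 + p.2)
      invFun := fun p => (p.1, p.2 - h p.1)
      left_inv := fun p => by simp
      right_inv := fun p => by simp
      measurable_toFun := by change Measurable fun p : γ × ℝ => (p.1, h p.1 + p.2); fun_prop
      measurable_invFun := by change Measurable fun p : γ × ℝ => (p.1, p.2 - h p.1); fun_prop }
  have h1 : μ.map U ⊗ₘ shiftKernel ν h = ((μ.map U).prod ν).map e := by
    ext s hs
    rw [Measure.compProd_apply hs, Measure.map_apply e.measurable hs,
      Measure.prod_apply (e.measurable hs)]
    refine lintegral_congr fun u => ?_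
    rw [shiftKernel_apply ν hh, Measure.map_apply (by fun_prop) (measurable_prodMk_left hs)]
    rfl
  have h2 : μ.map (fun ω => (U ω, Y ω)) = (μ.map fun ω => (U ω, Y ω - h (U ω))).map e := by
    rw [Measure.map_map e.measurable (by fun_prop)]
    congr 1
    funext ω
    simp [e]
  rw [h1, h2]
  exact (e.map_measurableEquiv_injective).eq_iff

/-- If the residual `Y - h(Z)` is independent of `Z`, then `Y` is conditionally independent of `W`
given `Z` iff the residual is independent of `(Z, W)`. -/
lemma condIndepFun_iff_indepFun_residual [StandardBorelSpace Ω] [StandardBorelSpace δ] [Nonempty δ]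
    [IsProbabilityMeasure μ] {Z : Ω → γ} (hZ : Measurable Z) {W : Ω → δ} (hW : Measurable W)
    {Y : Ω → ℝ} (hY : Measurable Y) {h : γ → ℝ} (hh : Measurable h)
    (hind : IndepFun Z (fun ω => Y ω - h (Z ω)) μ) :
    CondIndepFun (mγ.comap Z) hZ.comap_le Y W μ ↔
      IndepFun (fun ω => (Z ω, W ω)) (fun ω => Y ω - h (Z ω)) μ := by
  have hε : Measurable fun ω => Y ω - h (Z ω) := by fun_prop
  set ν := μ.map (fun ω => Y ω - h (Z ω)) with hν
  have : IsProbabilityMeasure ν := Measure.isProbabilityMeasure_map hε.aemeasurable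
  have h1 : condDistrib Y Z μ =ᵐ[μ.map Z] shiftKernel ν h := by
    rw [condDistrib_ae_eq_iff_measure_eq_compProd Z hY.aemeasurable,
      map_prodMk_eq_compProd_shiftKernel_iff ν hh hZ hY]
    exact (indepFun_iff_map_prod_eq_prod_map_map hZ.aemeasurable hε.aemeasurable).1 hind
  have hZW : Measurable fun ω => (Z ω, W ω) := by fun_prop
  -- Conditional independence says that the law of `Y` given (Z, W) ignores `W`. That law is then
  -- the shift of `ν` by h(Z), which characterizes independence of the residual from (Z, W).
  have h2 : (condDistrib Y Z μ).prodMkRight δ =ᵐ[μ.map fun ω => (Z ω, W ω)]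
      shiftKernel ν fun p : γ × δ => h p.1 := by
    have h3 : μ.map Z = (μ.map fun ω => (Z ω, W ω)).map Prod.fst := by
      rw [Measure.map_map measurable_fst hZW]
      rfl
    rw [h3] at h1
    filter_upwards [ae_of_ae_map measurable_fst.aemeasurable h1] with p hp
    rw [Kernel.prodMkRight_apply, hp, shiftKernel_apply ν hh,
      shiftKernel_apply ν (by fun_prop)]
  have h4 : CondIndepFun (mγ.comap Z) hZ.comap_le Y W μ ↔
      CondIndepFun (mγ.comap Z) hZ.comap_le W Y μ := ⟨fun h => h.symm, fun h => h.symm⟩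
  rw [h4, condIndepFun_iff_condDistrib_prod_ae_eq_prodMkRight hY hW hZ,
    indepFun_iff_map_prod_eq_prod_map_map hZW.aemeasurable hε.aemeasurable,
    ← map_prodMk_eq_compProd_shiftKernel_iff ν (h := fun p : γ × δ => h p.1) (by fun_prop) hZW hY,
    ← condDistrib_ae_eq_iff_measure_eq_compProd _ hY.aemeasurable]
  exact ⟨fun h => h.trans h2, fun h => h.trans h2.symm⟩

end CondIndep

/-! ### Least squares regression in L² -/

section Regression

variable {Ω ι : Type*} {mΩ : MeasurableSpace Ω} {μ : Measure Ω} [Fintype ι]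

/-- Orthogonal projection onto the span of a finite family. -/
lemma exists_inner_sub_sum_eq_zero {E : Type*} [NormedAddCommGroup E] [InnerProductSpace ℝ E]
    (y : E) (x : ι → E) : ∃ c : ι → ℝ, ∀ k, inner ℝ (y - ∑ k', c k' • x k') (x k) = 0 := by
  let K : Submodule ℝ E := Submodule.span ℝ (Set.range x)
  have : FiniteDimensional ℝ K := FiniteDimensional.span_of_finite ℝ (Set.finite_range x)
  obtain ⟨u, hu, z, hz, rfl⟩ := K.exists_add_mem_mem_orthogonal y
  obtain ⟨c, rfl⟩ := (Submodule.mem_span_range_iff_exists_fun ℝ).1 hu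
  refine ⟨c, fun k => ?_⟩
  rw [add_sub_cancel_left]
  exact (Submodule.mem_orthogonal' K z).1 hz _ (Submodule.subset_span ⟨k, rfl⟩)

/-- Least squares regression of `Y` on the variables `X k`. -/
lemma exists_covariance_sub_sum_eq_zero [IsProbabilityMeasure μ] {Y : Ω → ℝ} (hY : MemLp Y 2 μ)
    {X : ι → Ω → ℝ} (hX : ∀ k, MemLp (X k) 2 μ) :
    ∃ c : ι → ℝ, ∀ k, covariance (fun ω => Y ω - ∑ k, c k * X k ω) (X k) μ = 0 := by
  -- Centring turns covariance into the L² inner product. Orthogonal projection needs no linear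
  -- independence of the `X k`, so singular laws are covered.
  let ctr : (Ω → ℝ) → Ω → ℝ := fun V ω => V ω - ∫ a, V a ∂μ
  have hctr : ∀ {V : Ω → ℝ}, MemLp V 2 μ → MemLp (ctr V) 2 μ := fun hV =>
    hV.sub (memLp_const _)
  have hin : ∀ {V V' : Ω → ℝ} (hV : MemLp V 2 μ) (hV' : MemLp V' 2 μ),
      inner ℝ ((hctr hV).toLp _) ((hctr hV').toLp _) = covariance V V' μ := by
    intro V V' hV hV'
    rw [L2.inner_def, covariance]
    refine integral_congr_ae ?_
    filter_upwards [(hctr hV).coeFn_toLp, (hctr hV').coeFn_toLp] with ω h1 h2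
    rw [h1, h2]
    simp [ctr, mul_comm]
  let x : ι → Lp ℝ 2 μ := fun k => (hctr (hX k)).toLp _
  obtain ⟨c, hc⟩ := exists_inner_sub_sum_eq_zero ((hctr hY).toLp _) x
  refine ⟨c, fun k => ?_⟩
  have h1 := hc k
  rw [inner_sub_left, sum_inner, hin hY (hX k)] at h1
  simp only [inner_smul_left, RCLike.conj_to_real] at h1
  rw [covariance_fun_sub_left hY (memLp_finsetSum _ fun k _ => (hX k).const_mul _) (hX k),
    covariance_fun_sum_left (fun k => (hX k).const_mul _) (hX k), ← h1]
  congr 1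
  exact Finset.sum_congr rfl fun k' _ => by
    rw [covariance_const_mul_left, ← hin (hX k') (hX k)]

end Regression

/-! ### Gaussian laws and the points of loc(G) -/

section GaussianLaw

variable {n : ℕ} {G : Digraph (Fin n)}

lemma memLp_eval (P : Measure (Fin n → ℝ)) [IsGaussian P] (i : Fin n) :
    MemLp (fun x : Fin n → ℝ => x i) 2 P :=
  (IsGaussian.hasGaussianLaw_id (μ := P)).eval i |>.memLp_two

/-- In a Gaussian law, a linear functional uncorrelated with the coordinates in `A` is independent
of them. -/
lemma indepFun_proj_of_covariance_eq_zero (P : Measure (Fin n → ℝ)) [IsGaussian P]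
    (A : Finset (Fin n)) (L : (Fin n → ℝ) →L[ℝ] ℝ)
    (h : ∀ j ∈ A, covariance L (fun x : Fin n → ℝ => x j) P = 0) :
    IndepFun (proj A) L P := by
  let T : (Fin n → ℝ) →L[ℝ] (A → ℝ) × (Unit → ℝ) :=
    (ContinuousLinearMap.pi fun a : A => ContinuousLinearMap.proj (R := ℝ) (φ := fun _ => ℝ) (a : Fin n)).prod
      (ContinuousLinearMap.pi fun _ => L)
  have hT : HasGaussianLaw (fun x : Fin n → ℝ => (fun a : A => x a, fun _ : Unit => L x)) P :=
    (IsGaussian.hasGaussianLaw_id (μ := P)).map T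
  have := hT.indepFun_of_covariance_eval (X := fun (a : A) x => x a) (Y := fun _ : Unit => L)
    fun a _ => by rw [covariance_comm]; exact h a a.2
  exact this.comp measurable_id (measurable_pi_apply ())

/-- By joint Gaussianity the residual is independent of the parents, so the Markov relation means
that it is independent of parents and non-descendants together. Parents being non-descendants, this
is independence from the non-descendants alone, which for Gaussians is vanishing covariance. -/
lemma condIndepFun_iff_covariance_eq_zero (hG : IsAcyclic G) (P : ProbabilityMeasure (Fin n → ℝ))
    [IsGaussian (P : Measure (Fin n → ℝ))] (i : Fin n) (c : Fin n → ℝ)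
    (hc : ∀ j ∈ parents G i, covariance (fun x : Fin n → ℝ => x i - ∑ k ∈ parents G i, c k * x k)
      (fun x : Fin n → ℝ => x j) (P : Measure (Fin n → ℝ)) = 0) :
    CondIndepFun (MeasurableSpace.comap (proj (parents G i)) inferInstance)
      (measurable_proj (parents G i)).comap_le
      (fun x : Fin n → ℝ => x i) (proj (nonDesc G i)) (P : Measure (Fin n → ℝ)) ↔
    ∀ j ∈ nonDesc G i, covariance (fun x : Fin n → ℝ => x i - ∑ k ∈ parents G i, c k * x k)
      (fun x : Fin n → ℝ => x j) (P : Measure (Fin n → ℝ)) = 0 := by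
  let L : (Fin n → ℝ) →L[ℝ] ℝ := ContinuousLinearMap.proj (R := ℝ) (φ := fun _ => ℝ) i -
    ∑ k ∈ parents G i, c k • ContinuousLinearMap.proj (R := ℝ) (φ := fun _ => ℝ) k
  have hL : (fun x : Fin n → ℝ => x i - ∑ k ∈ parents G i, c k * x k) = L := by
    funext x
    simp [L]
  rw [hL] at hc ⊢
  let h : (parents G i → ℝ) → ℝ := fun z => ∑ k : parents G i, c k * z k
  have hh : Measurable h := by fun_prop
  have hres : (fun x : Fin n → ℝ => x i - h (proj (parents G i) x)) = L := by
    rw [← hL]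
    funext x
    simp only [h, proj]
    rw [Finset.sum_coe_sort (parents G i) fun k => c k * x k]
  have h1 := indepFun_proj_of_covariance_eq_zero (P : Measure (Fin n → ℝ)) (parents G i) L hc
  rw [condIndepFun_iff_indepFun_residual (measurable_proj _) (measurable_proj _)
    (measurable_pi_apply i) hh (by rw [hres]; exact h1), hres]
  constructor
  · intro hind j hj
    rw [covariance_comm]
    refine IndepFun.covariance_eq_zero ?_ (memLp_eval _ j)
      ((IsGaussian.hasGaussianLaw_id (μ := (P : Measure (Fin n → ℝ)))).map L).memLp_two
    exact hind.comp (φ := fun p : (parents G i → ℝ) × (nonDesc G i → ℝ) => p.2 ⟨j, hj⟩)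
      ((measurable_pi_apply _).comp measurable_snd) measurable_id
  · intro hcov
    have h2 := indepFun_proj_of_covariance_eq_zero (P : Measure (Fin n → ℝ)) (nonDesc G i) L hcov
    exact h2.comp (φ := fun w : nonDesc G i → ℝ =>
      ((fun k => w ⟨k, hG.parents_subset_nonDesc i k.2⟩ : parents G i → ℝ), w))
      (by fun_prop) measurable_id

/-- The covariance function of a law on `ℝⁿ`. -/
def covSym (P : Measure (Fin n → ℝ)) : Sym2 (Fin n) → ℝ :=
  Sym2.lift ⟨fun i j => covariance (fun x : Fin n → ℝ => x i) (fun x : Fin n → ℝ => x j) P,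
    fun _ _ => covariance_comm _ _⟩

lemma covSym_mk (P : Measure (Fin n → ℝ)) (i j : Fin n) : covSym P s(i, j) =
    covariance (fun x : Fin n → ℝ => x i) (fun x : Fin n → ℝ => x j) P := rfl

lemma covariance_residual (P : Measure (Fin n → ℝ)) [IsGaussian P] (i j : Fin n) (c : Fin n → ℝ)
    (K : Finset (Fin n)) :
    covariance (fun x : Fin n → ℝ => x i - ∑ k ∈ K, c k * x k) (fun x : Fin n → ℝ => x j) P =
      covSym P s(i, j) - ∑ k ∈ K, c k * covSym P s(k, j) := by
  rw [covariance_fun_sub_left (memLp_eval P i)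
    (memLp_finsetSum _ fun k _ => (memLp_eval P k).const_mul _) (memLp_eval P j),
    covariance_fun_sum_left' (fun k _ => (memLp_eval P k).const_mul _) (memLp_eval P j)]
  simp only [covariance_const_mul_left, covSym_mk]

lemma exists_isStructural_of_mem_Loc (hG : IsAcyclic G) {P : ProbabilityMeasure (Fin n → ℝ)}
    (hP : P ∈ Loc G) [IsGaussian (P : Measure (Fin n → ℝ))] :
    ∃ l w, IsStructural G (covSym (P : Measure (Fin n → ℝ))) l w := by
  suffices H : ∀ i, ∃ c : Fin n → ℝ, ∀ j ∈ nonDesc G i,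
      covSym (P : Measure (Fin n → ℝ)) s(i, j) =
        ∑ k ∈ parents G i, c k * covSym (P : Measure (Fin n → ℝ)) s(k, j) by
    choose l hl using H
    exact ⟨l, fun i => covSym (P : Measure (Fin n → ℝ)) s(i, i) -
      ∑ k ∈ parents G i, l i k * covSym (P : Measure (Fin n → ℝ)) s(k, i), hl, fun i => by ring⟩
  intro i
  obtain ⟨c, hc⟩ := exists_covariance_sub_sum_eq_zero (memLp_eval (P : Measure (Fin n → ℝ)) i)
    fun k : parents G i => memLp_eval (P : Measure (Fin n → ℝ)) k
  let d : Fin n → ℝ := fun k => if hk : k ∈ parents G i then c ⟨k, hk⟩ else 0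
  have hd : (fun x : Fin n → ℝ => x i - ∑ k ∈ parents G i, d k * x k) =
      fun x => x i - ∑ k, c k * x k := by
    funext x
    rw [← Finset.sum_coe_sort (parents G i)]
    simp [d]
  refine ⟨d, fun j hj => ?_⟩
  rw [← sub_eq_zero, ← covariance_residual]
  refine (condIndepFun_iff_covariance_eq_zero hG P i d fun j hj => ?_).1 (hP i) j hj
  rw [hd]
  exact hc ⟨j, hj⟩

lemma mem_Loc_of_isStructural (hG : IsAcyclic G) {P : ProbabilityMeasure (Fin n → ℝ)}
    [IsGaussian (P : Measure (Fin n → ℝ))] {l : Fin n → Fin n → ℝ} {w : Fin n → ℝ}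
    (h : IsStructural G (covSym (P : Measure (Fin n → ℝ))) l w) : P ∈ Loc G := by
  have key : ∀ i, ∀ j ∈ nonDesc G i,
      covariance (fun x : Fin n → ℝ => x i - ∑ k ∈ parents G i, l i k * x k)
        (fun x : Fin n → ℝ => x j) (P : Measure (Fin n → ℝ)) = 0 := fun i j hj => by
    rw [covariance_residual, h.nonDesc_eq i j hj, sub_self]
  intro i
  exact (condIndepFun_iff_covariance_eq_zero hG P i (l i) fun j hj =>
    key i j (hG.parents_subset_nonDesc i hj)).2 (key i)

lemma posSemidef_structuralCov (l : Fin n → Fin n → ℝ) {w : Fin n → ℝ} (hw : ∀ i, 0 ≤ w i) :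
    (symMatrix (structuralCov G l w)).PosSemidef := by
  have : symMatrix (structuralCov G l w) =
      pathMatrix G l * Matrix.diagonal w * (pathMatrix G l).conjTranspose := by
    ext i j
    simp [symMatrix, structuralCov_mk, Matrix.mul_apply, Matrix.diagonal_apply]
  rw [this]
  exact (Matrix.PosSemidef.diagonal hw).mul_mul_conjTranspose_same _

lemma exists_gaussian_covSym_eq {S : Sym2 (Fin n) → ℝ} (hS : (symMatrix S).PosSemidef) :
    ∃ P : ProbabilityMeasure (Fin n → ℝ), IsGaussian (P : Measure (Fin n → ℝ)) ∧
      covSym (P : Measure (Fin n → ℝ)) = S := by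
  let e := EuclideanSpace.equiv (Fin n) ℝ
  have hg : IsGaussian ((multivariateGaussian 0 (symMatrix S)).map e) := isGaussian_map_equiv e
  refine ⟨⟨(multivariateGaussian 0 (symMatrix S)).map e, inferInstance⟩, hg, ?_⟩
  funext z
  induction z with | h i j =>
  rw [covSym_mk]
  change covariance _ _ ((multivariateGaussian 0 (symMatrix S)).map e) = _
  rw [covariance_map (measurable_pi_apply i).aestronglyMeasurable
    (measurable_pi_apply j).aestronglyMeasurable (by fun_prop)]
  exact covariance_eval_multivariateGaussian hS i j

/-- Every structural covariance matrix with nonnegative error variances lies in `loc(G)`. -/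
lemma structuralCov_mem_loc (hG : IsAcyclic G) (l : Fin n → Fin n → ℝ) {w : Fin n → ℝ}
    (hw : ∀ i, 0 ≤ w i) : (fun z => ((structuralCov G l w z : ℝ) : ℂ)) ∈ loc G := by
  obtain ⟨P, hP, hcov⟩ := exists_gaussian_covSym_eq (posSemidef_structuralCov (G := G) l hw)
  refine ⟨P, mem_Loc_of_isStructural hG (l := l) (w := w) ?_, hP, fun i j => ?_⟩
  · rw [hcov]
    exact isStructural_structuralCov hG l w
  · rw [← hcov]
    rfl

lemma exists_isStructural_of_mem_loc (hG : IsAcyclic G) {σ : SymSpace n} (hσ : σ ∈ loc G) :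
    ∃ l w, IsStructural G σ l w := by
  obtain ⟨P, hP, hg, hcov⟩ := hσ
  obtain ⟨l, w, h⟩ := exists_isStructural_of_mem_Loc hG hP
  have h' := h.map Complex.ofRealHom
  have hσ' : σ = fun z => Complex.ofRealHom (covSym (P : Measure (Fin n → ℝ)) z) := by
    funext z
    induction z with | h i j => exact hcov i j
  rw [hσ']
  exact ⟨_, _, h'⟩

end GaussianLaw

/-! ### Zariski closure and saturation -/

section Zariski

variable {ι : Type*}

lemma zariskiClosure_eq (S : Set (ι → ℂ)) :
    zariskiClosure S = zeroLocus ℂ (vanishingIdeal ℂ S) := by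
  refine subset_antisymm (Set.sInter_subset_of_mem ⟨⟨_, rfl⟩, zeroLocus_vanishingIdeal_le S⟩) ?_
  rintro x hx Z ⟨⟨I, rfl⟩, hS⟩
  exact zeroLocus_anti_mono (le_zeroLocus_iff_le_vanishingIdeal.1 hS) hx

lemma vanishingIdeal_zariskiClosure (S : Set (ι → ℂ)) :
    vanishingIdeal ℂ (zariskiClosure S) = vanishingIdeal ℂ S := by
  rw [zariskiClosure_eq]
  exact zeroLocus_vanishingIdeal_galoisConnection.u_l_u_eq_u S

end Zariski

/-- As `φ f` is nonzero in a domain, `φ` extends to a map from `Localization.Away f` to the fraction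
field. It is used both for `param` and for evaluation at a point where θ₀ does not vanish. -/
lemma saturation_le {R A : Type*} [CommRing R] [CommRing A] [IsDomain A] (φ : R →+* A) {I : Ideal R}
    {f : R} (hI : I ≤ RingHom.ker φ) (hf : φ f ≠ 0) : saturation I f ≤ RingHom.ker φ := by
  let K := FractionRing A
  let ψ : R →+* K := (algebraMap A K).comp φ
  have hu : IsUnit (ψ f) := by
    rw [isUnit_iff_ne_zero]
    exact (map_ne_zero_iff _ (IsFractionRing.injective A K)).2 hf
  let ψ' : Localization.Away f →+* K := IsLocalization.Away.lift f hu
  have hcomp : ψ'.comp (algebraMap R _) = ψ := IsLocalization.Away.lift_comp f hu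
  have hle : I.map (algebraMap R (Localization.Away f)) ≤ RingHom.ker ψ' := by
    rw [Ideal.map_le_iff_le_comap]
    intro x hx
    have : φ x = 0 := hI hx
    have h2 := RingHom.congr_fun hcomp x
    simp only [RingHom.comp_apply, ψ, this, map_zero] at h2
    exact h2
  intro x hx
  have h1 : ψ' (algebraMap R _ x) = 0 := hle hx
  have h2 := RingHom.congr_fun hcomp x
  simp only [RingHom.comp_apply, h1, ψ] at h2
  exact (map_eq_zero_iff _ (IsFractionRing.injective A K)).1 h2.symm

/-- If the localization map `A → Aₚ` factors through a formally smooth algebra, then `Aₚ` is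
formally smooth. -/
lemma formallySmooth_atPrime_of_factor {k A P : Type*} [CommRing k] [CommRing A] [CommRing P]
    [Algebra k A] [Algebra k P] [Algebra.FormallySmooth k P] (p : Ideal A) [p.IsPrime]
    (f : A →ₐ[k] P) (g : P →ₐ[k] Localization.AtPrime p)
    (h : ∀ a, g (f a) = algebraMap A (Localization.AtPrime p) a) :
    Algebra.FormallySmooth k (Localization.AtPrime p) := by
  -- Inverting all elements of `P` that become units in `Localization.AtPrime p` gives a formally
  -- smooth `N` of which that local ring is a retract, via `s` and `r`. Lifts out of `N` then
  -- restrict along `s`.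
  let M : Submonoid P := (IsUnit.submonoid (Localization.AtPrime p)).comap (g : P →* _)
  let N := Localization M
  let r : N →ₐ[k] Localization.AtPrime p :=
    IsLocalization.liftAlgHom (M := M) (f := g) fun y => y.2
  have hs : ∀ y : p.primeCompl, IsUnit (((Algebra.ofId P N).restrictScalars k).comp f y) := by
    intro y
    refine IsLocalization.map_units N (⟨f y, ?_⟩ : M)
    change IsUnit (g (f y))
    rw [h]
    exact IsLocalization.map_units _ y
  let s : Localization.AtPrime p →ₐ[k] N := IsLocalization.liftAlgHom hs
  have hrs : r.comp s = AlgHom.id k _ := by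
    refine AlgHom.coe_ringHom_injective (IsLocalization.ringHom_ext p.primeCompl ?_)
    ext a
    have h1 : s (algebraMap A _ a) = algebraMap P N (f a) := IsLocalization.lift_eq _ a
    have h2 : r (algebraMap P N (f a)) = g (f a) := IsLocalization.lift_eq _ (f a)
    simp [h1, h2, h]
  refine Algebra.FormallySmooth.of_comp_surjective fun B _ _ I hI u => ?_
  obtain ⟨v, hv⟩ := Algebra.FormallySmooth.exists_lift I ⟨2, hI⟩ (u.comp r)
  refine ⟨v.comp s, ?_⟩
  change (Ideal.Quotient.mkₐ k I).comp (v.comp s) = u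
  rw [← AlgHom.comp_assoc, hv, AlgHom.comp_assoc, hrs, AlgHom.comp_id]

/-! ### The parametrization -/

section Parametrization

variable {n : ℕ} {G : Digraph (Fin n)}

/-- The ring of polynomials in edge coefficients and error variances. -/
abbrev ParamRing (n : ℕ) : Type := MvPolynomial ((Fin n × Fin n) ⊕ Fin n) ℂ

/-- The structural covariance matrix with indeterminate coefficients and error variances. -/
def genericCov (G : Digraph (Fin n)) : Sym2 (Fin n) → ParamRing n :=
  structuralCov G (fun i k => X (Sum.inl (i, k))) fun i => X (Sum.inr i)

/-- The parametrization, as a map of coordinate rings. -/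
def param (G : Digraph (Fin n)) : SymRing n →ₐ[ℂ] ParamRing n := aeval (genericCov G)

/-- Evaluation of the parameters. -/
def evalParam {R : Type*} [CommRing R] [Algebra ℂ R] (l : Fin n → Fin n → R) (w : Fin n → R) :
    ParamRing n →ₐ[ℂ] R :=
  aeval (Sum.elim (fun p => l p.1 p.2) w)

/-- Specializing `genericCov G` at `(l, w)` yields a structural solution with the same parameters as
`S`, hence `S` itself by uniqueness. -/
lemma IsStructural.evalParam_param (hG : IsAcyclic G) {R : Type*} [CommRing R] [Algebra ℂ R]
    {S : Sym2 (Fin n) → R} {l : Fin n → Fin n → R} {w : Fin n → R} (h : IsStructural G S l w)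
    (f : SymRing n) : evalParam l w (param G f) = aeval S f := by
  have h1 := (isStructural_structuralCov hG (fun i k => (X (Sum.inl (i, k)) : ParamRing n))
    fun i => X (Sum.inr i)).map (evalParam l w).toRingHom
  simp only [evalParam, AlgHom.toRingHom_eq_coe, RingHom.coe_coe, aeval_X, Sum.elim_inl,
    Sum.elim_inr] at h1
  have h2 := h1.unique hG h
  have h3 : (evalParam l w).comp (param G) = aeval S := by
    ext z
    simp only [param, AlgHom.comp_apply, aeval_X, ← h2]
    rfl
  exact AlgHom.congr_fun h3 f

lemma isStructural_genericCov (hG : IsAcyclic G) :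
    IsStructural G (genericCov G) (fun i k => X (Sum.inl (i, k))) fun i => X (Sum.inr i) :=
  isStructural_structuralCov hG _ _

lemma imposedIdeal_le_ker_param (hG : IsAcyclic G) :
    imposedIdeal G ≤ RingHom.ker (param G) := by
  rw [imposedIdeal, Ideal.span_le]
  rintro f ⟨i, j, hj, -, rfl⟩
  exact (isStructural_genericCov hG).aeval_ciMinor_eq_zero hG hj

/-- The identity matrix, all of whose principal minors are 1, shows that `param` does not kill θ₀.
-/
lemma isStructural_one :
    IsStructural G (fun z => if z.IsDiag then (1 : ℂ) else 0) (fun _ _ => 0) fun _ => 1 where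
  nonDesc_eq i j hj := by simp [(mem_nonDesc.1 hj).1.symm]
  diag_eq i := by simp

lemma param_theta_ne_zero (hG : IsAcyclic G) : param G (theta n) ≠ 0 := by
  intro h
  have h1 := (isStructural_one (G := G)).evalParam_param hG (theta n)
  rw [h, map_zero, theta, map_prod, eq_comm, Finset.prod_eq_zero_iff] at h1
  obtain ⟨A, -, hA⟩ := h1
  have : (symMatrix fun z : Sym2 (Fin n) => if z.IsDiag then (1 : ℂ) else 0) = 1 := by
    ext i j
    simp [symMatrix, Matrix.one_apply]
  rw [aeval_principalMinor, this, Matrix.submatrix_one _ Subtype.val_injective,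
    Matrix.det_one] at hA
  exact one_ne_zero hA

lemma ker_param_eq_saturation (hG : IsAcyclic G) :
    RingHom.ker (param G) = saturation (imposedIdeal G) (theta n) := by
  refine le_antisymm ?_ (saturation_le (param G).toRingHom (imposedIdeal_le_ker_param hG)
    (param_theta_ne_zero hG))
  intro f hf
  let A := Localization.Away (theta n)
  let J : Ideal A := (imposedIdeal G).map (algebraMap (SymRing n) A)
  -- The kernel of `q` is the saturation. The images of the coordinates are structural over the
  -- quotient, so `q` factors through `param`.
  let q : SymRing n →ₐ[ℂ] A ⧸ J :=
    (Ideal.Quotient.mkₐ ℂ J).comp ((Algebra.ofId (SymRing n) A).restrictScalars ℂ)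
  have hq : q = aeval fun z => q (X z) := by
    ext z
    simp
  have hker : ∀ g, q g = 0 ↔ g ∈ saturation (imposedIdeal G) (theta n) := fun g =>
    Ideal.Quotient.eq_zero_iff_mem
  have hunit : IsUnit (q (theta n)) :=
    (IsLocalization.Away.algebraMap_isUnit (S := A) (theta n)).map (Ideal.Quotient.mkₐ ℂ J)
  obtain ⟨l, w, h⟩ := exists_isStructural (G := G) (fun z => q (X z))
    (fun i => by
      rw [← hq]
      refine isUnit_of_dvd_unit (map_dvd q ?_) hunit
      exact Finset.dvd_prod_of_mem _ (Finset.mem_univ _))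
    (fun g hg => by
      rw [← hq, hker]
      exact Ideal.le_comap_map hg)
  rw [← hker, hq, ← h.evalParam_param hG, show param G f = 0 from hf, map_zero]

end Parametrization

/-! ### The ideal, the points and the smoothness of X_G -/

section DagVariety

variable {n : ℕ} {G : Digraph (Fin n)}

lemma vanishingIdeal_loc (hG : IsAcyclic G) :
    vanishingIdeal ℂ (loc G) = RingHom.ker (param G) := by
  refine le_antisymm (fun f hf => ?_) fun f hf σ hσ => ?_
  · let s : Set ℂ := (fun r : ℝ => (r : ℂ)) '' Set.Ici 0
    have hs : s.Infinite :=
      (Set.Ici_infinite (0 : ℝ)).image Complex.ofReal_injective.injOn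
    refine funext_set (fun _ => s) (fun _ => hs) fun x hx => ?_
    choose y hy0 hy using fun i => hx i trivial
    have h1 := ((isStructural_structuralCov hG (fun i k => y (Sum.inl (i, k)))
      fun i => y (Sum.inr i)).map Complex.ofRealHom).evalParam_param hG f
    have h2 := hf _ (structuralCov_mem_loc hG (fun i k => y (Sum.inl (i, k)))
      (w := fun i => y (Sum.inr i)) fun i => hy0 _)
    have h3 : x = Sum.elim (fun p => Complex.ofRealHom (y (Sum.inl (p.1, p.2))))
        fun i => Complex.ofRealHom (y (Sum.inr i)) := by
      funext z
      rcases z with z | z <;> exact (hy _).symm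
    rw [map_zero, ← coe_aeval_eq_eval, RingHom.coe_coe, h3]
    exact h1.trans h2
  · obtain ⟨l, w, h⟩ := exists_isStructural_of_mem_loc hG hσ
    rw [← h.evalParam_param hG, show param G f = 0 from hf, map_zero]

lemma dagIdeal_eq_vanishingIdeal_loc : dagIdeal G = vanishingIdeal ℂ (loc G) :=
  vanishingIdeal_zariskiClosure _

lemma dagIdeal_eq_ker_param (hG : IsAcyclic G) : dagIdeal G = RingHom.ker (param G) :=
  dagIdeal_eq_vanishingIdeal_loc.trans (vanishingIdeal_loc hG)

lemma dagVariety_eq_zeroLocus : dagVariety G = zeroLocus ℂ (dagIdeal G) := by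
  rw [dagIdeal_eq_vanishingIdeal_loc, dagVariety, zariskiClosure_eq]

lemma mem_dagVariety_of_theta_ne_zero (hG : IsAcyclic G) {x : SymSpace n}
    (hx : x ∈ zeroLocus ℂ (imposedIdeal G)) (hθ : aeval x (theta n) ≠ 0) : x ∈ dagVariety G := by
  rw [dagVariety_eq_zeroLocus, dagIdeal_eq_ker_param hG, ker_param_eq_saturation hG]
  exact saturation_le (aeval x : SymRing n →ₐ[ℂ] ℂ).toRingHom hx hθ

lemma isSmoothAtPoint_dagVariety (hG : IsAcyclic G) {x : SymSpace n} (hx : x ∈ dagVariety G)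
    (hns : x ∈ nonsingularLocus n) : IsSmoothAtPoint (dagVariety G) hx := by
  let A := CoordRing (dagVariety G)
  let L := Localization.AtPrime (pointIdeal hx)
  let π : SymRing n →ₐ[ℂ] A := Ideal.Quotient.mkₐ ℂ _
  let q : SymRing n →ₐ[ℂ] L := ((Algebra.ofId A L).restrictScalars ℂ).comp π
  have hq : q = aeval fun z => q (X z) := by
    ext z
    simp
  have hker : dagIdeal G = RingHom.ker (param G) := dagIdeal_eq_ker_param hG
  obtain ⟨l, w, h⟩ := exists_isStructural (G := G) (fun z => q (X z))
    (fun i => by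
      rw [← hq]
      refine IsLocalization.map_units L
        (⟨π (principalMinor (parents G i)), fun hmem => hns (parents G i) ?_⟩ :
          (pointIdeal hx).primeCompl)
      exact hmem)
    (fun f hf => by
      rw [← hq]
      have h0 : π f = 0 := Ideal.Quotient.eq_zero_iff_mem.2
        (hker.ge (imposedIdeal_le_ker_param hG hf))
      simp [q, h0])
  let φ : A →ₐ[ℂ] ParamRing n :=
    Ideal.Quotient.liftₐ (vanishingIdeal ℂ (dagVariety G)) (param G) fun f hf => hker.le hf
  refine formallySmooth_atPrime_of_factor (pointIdeal hx) φ (evalParam l w) fun a => ?_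
  obtain ⟨f, rfl⟩ := Ideal.Quotient.mk_surjective a
  change evalParam l w (param G f) = q f
  rw [h.evalParam_param hG, ← hq]

end DagVariety

end GaussianDAG

end

theorem mainTheorem1 (n : ℕ) (G : Digraph (Fin n)) (hG : GaussianDAG.IsAcyclic G) :
    -- (a) decomposition of the zero set of the ideal of imposed relations
    (∃ B : Set (GaussianDAG.SymSpace n), GaussianDAG.IsZariskiClosed B ∧
      B ⊆ {x | MvPolynomial.aeval x (GaussianDAG.theta n) = 0} ∧
      MvPolynomial.zeroLocus ℂ (GaussianDAG.imposedIdeal G) = GaussianDAG.dagVariety G ∪ B) ∧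
    -- (b) the prime ideal of the variety is the saturation
    (GaussianDAG.dagIdeal G = MvPolynomial.vanishingIdeal ℂ (GaussianDAG.loc G) ∧
      GaussianDAG.dagVariety G = MvPolynomial.zeroLocus ℂ (GaussianDAG.dagIdeal G) ∧
      (GaussianDAG.dagIdeal G).IsPrime ∧
      GaussianDAG.dagIdeal G =
        GaussianDAG.saturation (GaussianDAG.imposedIdeal G) (GaussianDAG.theta n)) ∧
    -- (c) smoothness where all principal minors are nonzero
    (∀ (x : GaussianDAG.SymSpace n) (hx : x ∈ GaussianDAG.dagVariety G),
      x ∈ GaussianDAG.nonsingularLocus n →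
        GaussianDAG.IsSmoothAtPoint (GaussianDAG.dagVariety G) hx) := by
  have hker := GaussianDAG.dagIdeal_eq_ker_param hG
  -- The set `B` is the whole part of V(I_G) where θ₀ = 0; it may meet X_G.
  refine ⟨⟨MvPolynomial.zeroLocus ℂ (GaussianDAG.imposedIdeal G ⊔ Ideal.span {GaussianDAG.theta n}),
    ⟨_, rfl⟩, fun x hx => hx _ (Ideal.mem_sup_right (Ideal.mem_span_singleton_self _)), ?_⟩,
    ⟨GaussianDAG.dagIdeal_eq_vanishingIdeal_loc, GaussianDAG.dagVariety_eq_zeroLocus, ?_,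
      hker.trans (GaussianDAG.ker_param_eq_saturation hG)⟩,
    fun x hx hns => GaussianDAG.isSmoothAtPoint_dagVariety hG hx hns⟩
  · refine subset_antisymm (fun x hx => ?_) (Set.union_subset ?_ ?_)
    · by_cases hθ : MvPolynomial.aeval x (GaussianDAG.theta n) = 0
      · refine Or.inr (MvPolynomial.le_zeroLocus_iff_le_vanishingIdeal.2 (sup_le ?_ ?_)
          (Set.mem_singleton x))
        · rintro p hp _ rfl
          exact hx p hp
        · rw [Ideal.span_singleton_le_iff_mem]
          rintro _ rfl
          exact hθ
      · exact Or.inl (GaussianDAG.mem_dagVariety_of_theta_ne_zero hG hx hθ)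
    · rw [GaussianDAG.dagVariety_eq_zeroLocus, hker]
      exact MvPolynomial.zeroLocus_anti_mono (GaussianDAG.imposedIdeal_le_ker_param hG)
    · exact MvPolynomial.zeroLocus_anti_mono le_sup_left
  · rw [hker]
    exact RingHom.ker_isPrime _
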